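/- Let $\bar w(x)=\Big(\int_0^1 e^{-s^{-1}(1-s)^{-1}}\,ds\Big)^{-1}e^{-x^{-1}(1-x)^{-1}}$ for $x\in(0,1)$ and $\bar w(x)=0$ otherwise. There is an absolute constant $\beta_*>0$ with the following property. Let $d\ge 1$ be an integer, $\mathbb T^d=(\mathbb R/\mathbb Z)^d$, let $E$ be a complex Banach space, and let $f:\mathbb T^d\to E$ be analytic in some neighbourhood of $\mathbb T^d$ in $\mathbb C^d$ (i.e., viewed as a $\mathbb Z^d$-periodic function on $\mathbb R^d$, $f$ extends to a complex analytic function on an open subset of $\mathbb C^d$ containing $\mathbb R^d$). Let $\tau>d-1$, $\alpha>0$, and put $\xi=\dfrac{\beta_*}{1+\tau\beta_*}>0$. Then there are constants $C,\tilde c,M>0$, depending only on $f,d,\tau,\alpha$, such that for every $\rho\in\mathbb R^d$ (with $\|k\|=|k_1|+\dots+|k_d|$) the following hold. (a) If $|k\cdot\rho-n|\ge\alpha\|k\|^{-\tau}$ for all $0\ne k\in\mathbb Z^d$ and all $n\in\mathbb Z$, then for all integers $N\ge M$ and all $\theta\in\mathbb T^d$ $$\Big\|\frac1{A_N}\sum_{n=0}^{N-1}\bar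 w\Big(\frac nN\Big)f(\theta+n\rho)-\int_{\mathbb T^d}f(\hat\theta)\,d\hat\theta\Big\|_E\le C\,e^{-\tilde cN^{\xi}},\qquad A_N=\sum_{n=0}^{N-1}\bar w\Big(\frac nN\Big).$$ (b) If $|k\cdot\rho|\ge\alpha\|k\|^{-\tau}$ for all $0\ne k\in\mathbb Z^d$, then for all real $T\ge M$ and all $\theta\in\mathbb T^d$ $$\Big\|\frac1T\int_0^T\bar w\Big(\frac tT\Big)f(\rho t+\theta)\,dt-\int_{\mathbb T^d}f(\hat\theta)\,d\hat\theta\Big\|_E\le C\,e^{-\tilde cT^{\xi}}.$$ -/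

import Mathlib

noncomputable section

/-- The unnormalised bump `x ↦ exp (- x⁻¹ (1 - x)⁻¹)` on `(0, 1)`, extended by zero. -/
def expBump (x : ℝ) : ℝ :=
  if 0 < x ∧ x < 1 then Real.exp (-(x⁻¹ * (1 - x)⁻¹)) else 0

/-- The weighting function `w̄`: the bump above, normalised to have integral one over `[0, 1]`. -/
def expWeight (x : ℝ) : ℝ :=
  (∫ s in (0 : ℝ)..1, expBump s)⁻¹ * expBump x

/-- The `ℓ¹`-length `‖k‖ = |k₁| + ⋯ + |k_d|` of an integer vector, as a real number. -/
def l1Length {d : ℕ} (k : Fin d → ℤ) : ℝ :=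
  ∑ i, |(k i : ℝ)|

/-- Nonresonance of `ρ` in the discrete case:
`|k · ρ - n| ≥ α / Δ(‖k‖)` for all nonzero `k ∈ ℤ^d` and all `n ∈ ℤ`. -/
def DiscreteNonresonant {d : ℕ} (α : ℝ) (Δ : ℝ → ℝ) (ρ : Fin d → ℝ) : Prop :=
  ∀ k : Fin d → ℤ, k ≠ 0 → ∀ n : ℤ,
    α / Δ (l1Length k) ≤ |(∑ i, (k i : ℝ) * ρ i) - (n : ℝ)|

/-- Nonresonance of `ρ` in the continuous case:
`|k · ρ| ≥ α / Δ(‖k‖)` for all nonzero `k ∈ ℤ^d`. -/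
def ContinuousNonresonant {d : ℕ} (α : ℝ) (Δ : ℝ → ℝ) (ρ : Fin d → ℝ) : Prop :=
  ∀ k : Fin d → ℤ, k ≠ 0 →
    α / Δ (l1Length k) ≤ |∑ i, (k i : ℝ) * ρ i|

/-- Reduction modulo one in every coordinate, `ℝ^d → 𝕋^d = (ℝ/ℤ)^d`. -/
def toTorus {d : ℕ} (x : Fin d → ℝ) : UnitAddTorus (Fin d) :=
  fun i => (x i : UnitAddCircle)

/-- The rotation `T_ρ θ = θ + ρ mod 1` of the torus. -/
def torusRotation {d : ℕ} (ρ : Fin d → ℝ) (θ : UnitAddTorus (Fin d)) : UnitAddTorus (Fin d) :=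
  θ + toTorus ρ

/-- The space average `∫_{𝕋^d} f dθ` with respect to the normalised Haar (Lebesgue) measure. -/
def torusMean {d : ℕ} {E : Type*} [NormedAddCommGroup E] [NormedSpace ℝ E]
    (f : UnitAddTorus (Fin d) → E) : E :=
  ∫ θ, f θ ∂(MeasureTheory.Measure.pi fun _ : Fin d => (AddCircle.haarAddCircle (T := (1 : ℝ))))

/-- `f : 𝕋^d → E` is analytic in some neighbourhood of `𝕋^d` in `ℂ^d`: seen as a periodic function
on `ℝ^d`, it extends to a complex analytic function on an open set of `ℂ^d` containing `ℝ^d`. -/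
def AnalyticNearTorus {d : ℕ} {E : Type*} [NormedAddCommGroup E] [NormedSpace ℂ E]
    (f : UnitAddTorus (Fin d) → E) : Prop :=
  ∃ (U : Set (Fin d → ℂ)) (F : (Fin d → ℂ) → E), IsOpen U ∧ AnalyticOnNhd ℂ F U ∧
    ∀ x : Fin d → ℝ, (fun i => (x i : ℂ)) ∈ U ∧ F (fun i => (x i : ℂ)) = f (toTorus x)

/-- The discrete weighted Birkhoff average
`A_N⁻¹ ∑_{n < N} w̄(n/N) f(T_ρ^n θ)`, where `A_N = ∑_{n < N} w̄(n/N)`. -/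
def discreteAverage {d : ℕ} {E : Type*} [NormedAddCommGroup E] [NormedSpace ℂ E]
    (ρ : Fin d → ℝ) (f : UnitAddTorus (Fin d) → E) (N : ℕ) (θ : UnitAddTorus (Fin d)) : E :=
  (((∑ n ∈ Finset.range N, expWeight ((n : ℝ) / (N : ℝ)))⁻¹ : ℝ) : ℂ) •
    ∑ n ∈ Finset.range N,
      ((expWeight ((n : ℝ) / (N : ℝ)) : ℝ) : ℂ) • f ((torusRotation ρ)^[n] θ)

/-- The continuous weighted Birkhoff average `T⁻¹ ∫_0^T w̄(t/T) f(ρ t + θ) dt`. -/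
def continuousAverage {d : ℕ} {E : Type*} [NormedAddCommGroup E] [NormedSpace ℂ E]
    (ρ : Fin d → ℝ) (f : UnitAddTorus (Fin d) → E) (T : ℝ) (θ : UnitAddTorus (Fin d)) : E :=
  ((T⁻¹ : ℝ) : ℂ) •
    ∫ t in (0 : ℝ)..T, ((expWeight (t / T) : ℝ) : ℂ) • f (toTorus (fun i => ρ i * t) + θ)

end

/-! Expand `f` in a Fourier series. Averaging the character of frequency `k` along the orbit gives a
unimodular factor times the Fourier transform `ŵ` of the weight: at `-T (k · ρ)` in continuous time,
and, by Poisson summation, a sum of `N ŵ(N (m - k · ρ))` over integers `m`, divided by `A_N`, in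
discrete time.

The weight has Gevrey order 2: Cauchy estimates on discs of radius `x (1 - x) / 2` bound the `m`-th
derivative of the bump by `(9 m²)^m` (`norm_iteratedDeriv_expBump_le`), hence `|ŵ(ξ)| ≤ D exp (-κ
|ξ|^(1/2))` (`exists_norm_fourier_expWeight_le`). This square root is the source of `βstar = 1/2`.
Analyticity makes the Fourier coefficients of `f` decay like `exp (-r ‖k‖)`
(`norm_mFourierCoeff_le`).

With small divisors at least `α ‖k‖^(-τ)`, the term of frequency `k` has size `exp (-r ‖k‖ - c √(X α
‖k‖^(-τ)))`, where `X` is `N` or `T`. The two parts of the exponent balance at `‖k‖ = X^ξ`, `ξ = 1 /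
(2 + τ)` (`min_mul_rpow_le`). Everything is proved for scalar functions, uniformly over functionals
of norm at most one, and Hahn–Banach transfers it to `E`. -/

/-! ### Real derivatives of holomorphic functions; optimising over the order -/

-- This allows Cauchy estimates for a holomorphic extension to bound real derivatives.
open Complex Filter Topology in
theorem iteratedDeriv_eq_of_eqOn_ofReal {h : ℝ → ℂ} {G : ℂ → ℂ} {V : Set ℂ} (hV : IsOpen V)
    (hG : DifferentiableOn ℂ G V) (hh : ∀ x : ℝ, (x : ℂ) ∈ V → h x = G x) (m : ℕ) :
    ∀ x : ℝ, (x : ℂ) ∈ V → iteratedDeriv m h x = iteratedDeriv m G x := by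
  induction m with
  | zero => simpa using hh
  | succ m ih =>
    intro x hx
    have hev : iteratedDeriv m h =ᶠ[𝓝 x] fun y : ℝ => iteratedDeriv m G y := by
      filter_upwards [Complex.continuous_ofReal.continuousAt.eventually (hV.mem_nhds hx)] with y hy
      exact ih y hy
    have hd : DifferentiableAt ℂ (iteratedDeriv m G) x := by
      have := (hG.analyticOnNhd hV).iterated_deriv m
      rw [← iteratedDeriv_eq_iterate] at this
      exact (this x hx).differentiableAt
    rw [iteratedDeriv_succ, iteratedDeriv_succ, hev.deriv_eq]
    exact hd.hasDerivAt.comp_ofReal.deriv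

/-- Optimisation in `m` of a family of bounds `a x ^ m ≤ B (K m ^ s) ^ m`. -/
theorem le_exp_neg_rpow_of_forall_mul_pow_le {a B K x : ℝ} {s : ℕ} (hs : s ≠ 0) (hB : 0 ≤ B)
    (hK : 0 < K) (hx : 0 ≤ x) (h : ∀ m : ℕ, a * x ^ m ≤ B * (K * (m : ℝ) ^ s) ^ m) :
    a ≤ B * Real.exp 1 * Real.exp (-((x / (Real.exp 1 * K)) ^ ((s : ℝ)⁻¹))) := by
  have he := Real.exp_pos 1
  have hs' : ((s : ℝ)⁻¹) ≠ 0 := by positivity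
  rcases hx.eq_or_lt with rfl | hx
  · have h0 := h 0
    simp only [pow_zero, mul_one] at h0
    rw [zero_div, Real.zero_rpow hs', neg_zero, Real.exp_zero, mul_one]
    exact h0.trans (le_mul_of_one_le_right hB (Real.one_le_exp zero_le_one))
  set y : ℝ := (x / (Real.exp 1 * K)) ^ ((s : ℝ)⁻¹) with hy
  have hy0 : 0 ≤ y := by positivity
  have hys : y ^ s = x / (Real.exp 1 * K) := Real.rpow_inv_natCast_pow (by positivity) hs
  -- With `m ≤ y` the base `K m^s` is at most `x / e`, so each of the `m` factors gains `e⁻¹`;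
  -- rounding down costs one factor `e`.
  set m := ⌊y⌋₊
  have hm : (m : ℝ) ≤ y := Nat.floor_le hy0
  have hm' : y - 1 ≤ m := (Nat.sub_one_lt_floor y).le
  have hb : K * (m : ℝ) ^ s ≤ x * (Real.exp 1)⁻¹ := by
    calc K * (m : ℝ) ^ s ≤ K * y ^ s := by gcongr
      _ = x * (Real.exp 1)⁻¹ := by rw [hys]; field_simp
  have h1 : a * x ^ m ≤ (B * Real.exp (-m)) * x ^ m := by
    calc a * x ^ m ≤ B * (K * (m : ℝ) ^ s) ^ m := h m
      _ ≤ B * (x * (Real.exp 1)⁻¹) ^ m := by gcongr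
      _ = (B * Real.exp (-m)) * x ^ m := by
        rw [mul_pow, ← Real.exp_neg, ← Real.exp_nat_mul]; ring_nf
  calc a ≤ B * Real.exp (-m) := le_of_mul_le_mul_right h1 (by positivity)
    _ ≤ B * Real.exp (1 + -y) := by gcongr; linarith
    _ = _ := by rw [Real.exp_add, mul_assoc]

theorem factorial_le_natCast_pow (m : ℕ) : (m.factorial : ℝ) ≤ (m : ℝ) ^ m := by
  exact_mod_cast Nat.factorial_le_pow m

/-! ### The bump function -/

/-- Partial fractions, `1 / (x (1 - x)) = 1 / x + 1 / (1 - x)`, reduce smoothness to that of the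
one-sided glue function. -/
theorem expBump_eq_mul (x : ℝ) : expBump x = expNegInvGlue x * expNegInvGlue (1 - x) := by
  unfold expBump expNegInvGlue
  by_cases h0 : 0 < x
  · by_cases h1 : x < 1
    · rw [if_pos ⟨h0, h1⟩, if_neg (by linarith), if_neg (by linarith), ← Real.exp_add]
      congr 1
      have : 1 - x ≠ 0 := by linarith
      field_simp
      ring
    · rw [if_neg (by tauto), if_neg (by linarith), if_pos (by linarith), mul_zero]
  · rw [if_neg (by tauto), if_pos (by linarith), zero_mul]

theorem contDiff_expBump {n : ℕ∞} : ContDiff ℝ n expBump := by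
  rw [funext expBump_eq_mul]
  exact expNegInvGlue.contDiff.mul (expNegInvGlue.contDiff.comp (contDiff_const.sub contDiff_id))

theorem continuous_expBump : Continuous expBump := (contDiff_expBump (n := 0)).continuous

theorem expBump_nonneg (x : ℝ) : 0 ≤ expBump x := by
  unfold expBump; split_ifs <;> positivity

theorem expBump_pos {x : ℝ} (h0 : 0 < x) (h1 : x < 1) : 0 < expBump x := by
  rw [expBump, if_pos ⟨h0, h1⟩]; positivity

theorem expBump_eq_zero {x : ℝ} (h : x ∉ Set.Ioo (0 : ℝ) 1) : expBump x = 0 :=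
  if_neg h

theorem integral_expBump_pos : 0 < ∫ s in (0 : ℝ)..1, expBump s :=
  intervalIntegral.intervalIntegral_pos_of_pos_on
    (continuous_expBump.intervalIntegrable _ _) (fun _ hx => expBump_pos hx.1 hx.2) one_pos

theorem continuous_expWeight : Continuous expWeight := continuous_const.mul continuous_expBump

theorem expWeight_nonneg (x : ℝ) : 0 ≤ expWeight x :=
  mul_nonneg (inv_nonneg.2 integral_expBump_pos.le) (expBump_nonneg x)

theorem expWeight_eq_zero {x : ℝ} (h : x ∉ Set.Ioo (0 : ℝ) 1) : expWeight x = 0 := by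
  rw [expWeight, expBump_eq_zero h, mul_zero]

theorem integral_expWeight : ∫ s in (0 : ℝ)..1, expWeight s = 1 := by
  unfold expWeight
  rw [intervalIntegral.integral_const_mul, inv_mul_cancel₀ integral_expBump_pos.ne']

theorem pow_mul_exp_neg_le {c y : ℝ} (hc : 0 < c) (hy : 0 ≤ y) (m : ℕ) :
    y ^ m * Real.exp (-(c * y)) ≤ m.factorial * c⁻¹ ^ m := by
  have h := Real.pow_div_factorial_le_exp (c * y) (mul_nonneg hc.le hy) m
  rw [div_le_iff₀ (by positivity), mul_pow] at h
  rw [Real.exp_neg, ← div_eq_mul_inv, div_le_iff₀ (Real.exp_pos _), inv_pow, mul_right_comm,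
    ← div_eq_mul_inv, le_div_iff₀ (by positivity)]
  linarith

/-- If `z` is within `x / 2` of `x > 0`, then `Re z⁻¹ ≥ 2 / (9 x)`. -/
theorem le_re_inv_of_norm_sub_le {x : ℝ} (hx : 0 < x) {z : ℂ} (hz : ‖z - x‖ ≤ x / 2) :
    2 / 9 * x⁻¹ ≤ (z⁻¹).re ∧ 0 < z.re := by
  have hre : x / 2 ≤ z.re := by
    have := (abs_le.1 ((Complex.abs_re_le_norm (z - x)).trans hz)).1
    simp at this
    linarith
  have hn : ‖z‖ ≤ 3 / 2 * x := by
    calc ‖z‖ = ‖(z - x) + x‖ := by ring_nf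
      _ ≤ ‖z - x‖ + ‖(x : ℂ)‖ := norm_add_le _ _
      _ ≤ _ := by rw [Complex.norm_real, Real.norm_of_nonneg hx.le]; linarith
  have hz0 : z ≠ 0 := by rintro rfl; simp at hre; linarith
  have hn0 : 0 < ‖z‖ := norm_pos_iff.2 hz0
  refine ⟨?_, by linarith⟩
  rw [Complex.inv_re, Complex.normSq_eq_norm_sq, le_div_iff₀ (by positivity)]
  calc 2 / 9 * x⁻¹ * ‖z‖ ^ 2 ≤ 2 / 9 * x⁻¹ * (3 / 2 * x) ^ 2 := by gcongr
    _ = x / 2 := by field_simp; ring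
    _ ≤ _ := hre

-- The Cauchy estimate at radius `q / 2` costs `m! (2 / q)^m`, but there the extension is at most
-- `exp (-2 / (9 q))`, which absorbs `q^(-m)` at the price of a second `m!`. The two factorials give
-- Gevrey order 2, uniformly up to the endpoints.
open Complex in
theorem norm_iteratedDeriv_expBump_le {x : ℝ} (hx : x ∈ Set.Ioo (0 : ℝ) 1) (m : ℕ) :
    ‖iteratedDeriv m (fun t : ℝ => (expBump t : ℂ)) x‖ ≤ (9 * (m : ℝ) ^ 2) ^ m := by
  obtain ⟨h0, h1⟩ := hx
  set q : ℝ := x * (1 - x) with hq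
  have h1' : 0 < 1 - x := by linarith
  have hq0 : 0 < q := by positivity
  set G : ℂ → ℂ := fun z => Complex.exp (-(z⁻¹ + (1 - z)⁻¹)) with hG
  set V : Set ℂ := {z | 0 < z.re} ∩ {z | z.re < 1} with hV
  have hVo : IsOpen V := (isOpen_lt continuous_const Complex.continuous_re).inter
    (isOpen_lt Complex.continuous_re continuous_const)
  have hGd : DifferentiableOn ℂ G V := by
    intro z hz
    have hz0 : z ≠ 0 := by rintro rfl; simpa using hz.1
    have hz1 : 1 - z ≠ 0 := by
      intro h
      rw [← sub_eq_zero.1 h] at hz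
      simpa using hz.2
    exact (((differentiableAt_id.inv hz0).add
      (((differentiableAt_const _).sub differentiableAt_id).inv hz1)).neg.cexp).differentiableWithinAt
  have heq : ∀ t : ℝ, (t : ℂ) ∈ V → (expBump t : ℂ) = G t := by
    intro t ht
    have ht0 : 0 < t := by simpa using ht.1
    have ht1 : t < 1 := by simpa using ht.2
    have : 1 - t ≠ 0 := by linarith
    rw [expBump, if_pos ⟨ht0, ht1⟩, hG]
    have e : t⁻¹ * (1 - t)⁻¹ = t⁻¹ + (1 - t)⁻¹ := by field_simp; ring
    rw [e]
    push_cast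
    rfl
  have hxV : (x : ℂ) ∈ V := by simp [hV, h0, h1]
  -- Since `q ≤ x` and `q ≤ 1 - x`, the disc stays within half the distance to each singularity, `0`
  -- and `1`.
  have hball : ∀ z : ℂ, ‖z - x‖ ≤ q / 2 →
      z ∈ V ∧ ‖G z‖ ≤ Real.exp (-(2 / 9 * q⁻¹)) := by
    intro z hz
    have ha := le_re_inv_of_norm_sub_le h0 (z := z) (hz.trans (by rw [hq]; nlinarith))
    have hb := le_re_inv_of_norm_sub_le h1' (z := 1 - z) (by
      have : (1 - z) - ((1 - x : ℝ) : ℂ) = -(z - x) := by push_cast; ring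
      rw [this, norm_neg]
      exact hz.trans (by rw [hq]; nlinarith))
    refine ⟨⟨ha.2, by simpa using hb.2⟩, ?_⟩
    rw [hG, Complex.norm_exp]
    gcongr
    have e : q⁻¹ = x⁻¹ + (1 - x)⁻¹ := by rw [hq]; field_simp; ring
    rw [e, Complex.neg_re, Complex.add_re]
    linarith [ha.1, hb.1]
  rw [iteratedDeriv_eq_of_eqOn_ofReal hVo hGd heq m x hxV]
  have hc := Complex.norm_iteratedDeriv_le_of_forall_mem_sphere_norm_le (c := (x : ℂ)) (f := G)
    (R := q / 2) (C := Real.exp (-(2 / 9 * q⁻¹))) m (by positivity)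
    (DifferentiableOn.diffContOnCl (fun z hz => (hGd z (hball z ?_).1).mono fun y hy =>
      (hball y ?_).1)) (fun z hz => (hball z (by simpa [dist_eq_norm] using hz.le)).2)
  · have hp := pow_mul_exp_neg_le (c := 2 / 9) (y := q⁻¹) (by norm_num) (by positivity) m
    calc _ ≤ _ := hc
      _ = m.factorial * 2 ^ m * (q⁻¹ ^ m * Real.exp (-(2 / 9 * q⁻¹))) := by
        rw [div_pow, inv_pow]; field_simp
      _ ≤ m.factorial * 2 ^ m * (m.factorial * (2 / 9)⁻¹ ^ m) := by gcongr
      _ = 9 ^ m * ((m.factorial : ℝ) * m.factorial) := by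
        rw [show (9 : ℝ) = 2 * (2 / 9)⁻¹ by norm_num, mul_pow]; norm_num; ring
      _ ≤ 9 ^ m * ((m : ℝ) ^ m * (m : ℝ) ^ m) := by gcongr <;> exact factorial_le_natCast_pow m
      _ = _ := by rw [mul_pow, ← pow_mul, mul_comm 2 m, pow_mul]; ring
  · have := Metric.closure_ball_subset_closedBall hz
    simpa [dist_eq_norm] using this
  · have := Metric.closure_ball_subset_closedBall hy
    simpa [dist_eq_norm] using this

/-! ### Decay of the Fourier transform of the weight -/

-- Differentiating `m` times multiplies the transform by `(2πiξ)^m`, and the derivative is supported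
-- in an interval of length one.
open MeasureTheory FourierTransform in
theorem norm_fourier_expBump_mul_pow_le (ξ : ℝ) (m : ℕ) :
    ‖𝓕 (fun t : ℝ => (expBump t : ℂ)) ξ‖ * |ξ| ^ m ≤ 1 * (9 * (m : ℝ) ^ 2) ^ m := by
  set f : ℝ → ℂ := fun t => (expBump t : ℂ) with hf
  have hfc : ContDiff ℝ (⊤ : ℕ∞) f := Complex.ofRealCLM.contDiff.comp contDiff_expBump
  have hcont : ∀ n, Continuous (iteratedDeriv n f) := fun n =>
    hfc.continuous_iteratedDeriv n (by exact_mod_cast le_top)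
  -- The endpoints are reached by continuity from the open half-lines where the bump vanishes
  -- identically.
  have hzero : ∀ n, ∀ t ∉ Set.Ioo (0 : ℝ) 1, iteratedDeriv n f t = 0 := by
    intro n t ht
    have key : ∀ s : Set ℝ, IsOpen s → (∀ u ∈ s, u ∉ Set.Ioo (0 : ℝ) 1) → t ∈ closure s →
        iteratedDeriv n f t = 0 := by
      intro s hs hs0 hts
      refine Set.EqOn.closure (f := iteratedDeriv n f) (g := fun _ => 0) (s := s) ?_ (hcont n)
        continuous_const hts
      intro u hu
      have : f =ᶠ[nhds u] fun _ => (0 : ℂ) := by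
        filter_upwards [hs.mem_nhds hu] with v hv
        simp [hf, expBump_eq_zero (hs0 v hv)]
      rw [this.iteratedDeriv_eq n, iteratedDeriv_const]
      simp
    rcases le_or_gt t 0 with h | h
    · exact key (Set.Iio 0) isOpen_Iio (fun u hu h' => lt_asymm hu h'.1)
        (by rw [closure_Iio]; exact h)
    · refine key (Set.Ioi 1) isOpen_Ioi (fun u hu h' => lt_asymm hu h'.2) ?_
      rw [closure_Ioi]
      by_contra h'
      exact ht ⟨h, not_le.1 h'⟩
  have hint : ∀ n, Integrable (iteratedDeriv n f) := fun n =>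
    (hcont n).integrable_of_hasCompactSupport (HasCompactSupport.intro (K := Set.Icc 0 1)
      isCompact_Icc fun t ht => hzero n t fun h => ht (Set.Ioo_subset_Icc_self h))
  have hF := congrFun (Real.fourier_iteratedDeriv (N := ⊤) (n := m) hfc (fun n _ => hint n) le_top) ξ
  have hle : ‖𝓕 (iteratedDeriv m f) ξ‖ ≤ (9 * (m : ℝ) ^ 2) ^ m := by
    calc ‖𝓕 (iteratedDeriv m f) ξ‖ ≤ ∫ t, ‖iteratedDeriv m f t‖ :=
          VectorFourier.norm_fourierIntegral_le_integral_norm _ _ _ _ _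
      _ = ∫ t in Set.Ioo (0 : ℝ) 1, ‖iteratedDeriv m f t‖ :=
          (setIntegral_eq_integral_of_forall_compl_eq_zero fun t ht => by
            rw [hzero m t ht, norm_zero]).symm
      _ ≤ ‖∫ t in Set.Ioo (0 : ℝ) 1, ‖iteratedDeriv m f t‖‖ := le_abs_self _
      _ ≤ (9 * (m : ℝ) ^ 2) ^ m * volume.real (Set.Ioo (0 : ℝ) 1) :=
          norm_setIntegral_le_of_norm_le_const (by simp) fun t ht => by
            rw [norm_norm]; exact norm_iteratedDeriv_expBump_le ht m
      _ = _ := by simp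
  rw [hF, norm_smul, norm_pow] at hle
  rw [one_mul]
  refine le_trans ?_ hle
  rw [mul_comm]
  gcongr
  rw [norm_mul, Complex.norm_real, Real.norm_eq_abs, norm_mul, norm_mul, Complex.norm_I,
    Complex.norm_real, Real.norm_of_nonneg Real.pi_pos.le, Complex.norm_ofNat, mul_one]
  exact le_mul_of_one_le_left (abs_nonneg _) (by linarith [Real.pi_gt_three])

open FourierTransform in
theorem exists_norm_fourier_expWeight_le :
    ∃ D κ : ℝ, 0 < D ∧ 0 < κ ∧ ∀ ξ : ℝ,
      ‖𝓕 (fun t : ℝ => (expWeight t : ℂ)) ξ‖ ≤ D * Real.exp (-(κ * √|ξ|)) := by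
  have he := Real.exp_pos 1
  refine ⟨(∫ s in (0 : ℝ)..1, expBump s)⁻¹ * Real.exp 1, √((Real.exp 1 * 9)⁻¹),
    mul_pos (inv_pos.2 integral_expBump_pos) he, by positivity, fun ξ => ?_⟩
  have hb := le_exp_neg_rpow_of_forall_mul_pow_le two_ne_zero zero_le_one (by norm_num)
    (abs_nonneg ξ) (norm_fourier_expBump_mul_pow_le ξ)
  have hw : 𝓕 (fun t : ℝ => (expWeight t : ℂ)) ξ =
      ((∫ s in (0 : ℝ)..1, expBump s)⁻¹ : ℝ) * 𝓕 (fun t : ℝ => (expBump t : ℂ)) ξ := by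
    rw [Real.fourier_real_eq_integral_exp_smul, Real.fourier_real_eq_integral_exp_smul,
      ← MeasureTheory.integral_const_mul]
    congr 1
    ext t
    simp only [expWeight, smul_eq_mul, Complex.ofReal_mul]
    ring
  rw [hw, norm_mul, Complex.norm_real, Real.norm_of_nonneg (inv_nonneg.2 integral_expBump_pos.le),
    mul_assoc]
  refine mul_le_mul_of_nonneg_left ?_ (inv_nonneg.2 integral_expBump_pos.le)
  rw [one_mul] at hb
  rwa [← Real.sqrt_mul (by positivity), inv_mul_eq_div, Real.sqrt_eq_rpow, one_div]

theorem summable_exp_neg_mul_sqrt_abs {c : ℝ} (hc : 0 < c) :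
    Summable fun n : ℤ => Real.exp (-(c * √|(n : ℝ)|)) := by
  have h : Summable fun n : ℕ => Real.exp (-(c * √(n : ℝ))) := by
    refine Summable.of_norm_bounded_eventually_nat
      ((Real.summable_one_div_nat_pow.2 one_lt_two).mul_left ((Nat.factorial 4 : ℝ) * c⁻¹ ^ 4)) ?_
    filter_upwards [Filter.eventually_gt_atTop 0] with n hn
    have hn' : (0 : ℝ) < n := by exact_mod_cast hn
    have := pow_mul_exp_neg_le hc (Real.sqrt_nonneg n) 4
    rw [Real.norm_of_nonneg (Real.exp_pos _).le, mul_one_div, le_div_iff₀ (by positivity)]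
    rw [show (√(n : ℝ)) ^ 4 = (n : ℝ) ^ 2 by
      rw [show 4 = 2 * 2 from rfl, pow_mul, Real.sq_sqrt hn'.le]] at this
    linarith
  refine Summable.of_nat_of_neg ?_ ?_ <;> simpa using h

/-- Makes the sums over the shifted lattice `m - x` uniform in `x`. -/
theorem sqrt_abs_le_sqrt_abs_sub_add_one {x y : ℝ} (hx0 : 0 ≤ x) (hx1 : x ≤ 1) :
    √|y| ≤ √|y - x| + 1 := by
  rw [Real.sqrt_le_left (by positivity)]
  have h1 : |y| ≤ |y - x| + 1 := by
    calc |y| = |(y - x) + x| := by ring_nf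
      _ ≤ |y - x| + |x| := abs_add_le _ _
      _ ≤ _ := by rw [abs_of_nonneg hx0]; linarith
  nlinarith [Real.sq_sqrt (abs_nonneg (y - x)), Real.sqrt_nonneg |y - x|]

/-! ### Weighted exponential sums -/

open FourierTransform in
theorem fourier_expWeight_modulated {N : ℝ} (hN : 0 < N) (x ξ : ℝ) :
    𝓕 (fun t : ℝ => (expWeight (t / N) : ℂ) * Complex.exp (2 * Real.pi * Complex.I * (t * x))) ξ =
      N * 𝓕 (fun t : ℝ => (expWeight t : ℂ)) (N * (ξ - x)) := by
  rw [Real.fourier_real_eq_integral_exp_smul, Real.fourier_real_eq_integral_exp_smul]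
  have := MeasureTheory.Measure.integral_comp_div (fun t : ℝ =>
    Complex.exp (↑(-2 * Real.pi * t * (N * (ξ - x))) * Complex.I) • (expWeight t : ℂ)) N
  rw [abs_of_pos hN, Complex.real_smul] at this
  rw [← this]
  congr 1
  ext t
  simp only [smul_eq_mul]
  rw [mul_left_comm, ← Complex.exp_add, mul_comm]
  congr 2
  have hN' : (N : ℂ) ≠ 0 := by exact_mod_cast hN.ne'
  push_cast
  field_simp
  ring

open FourierTransform in
/-- Poisson summation for the exponential sums weighted by `expWeight`. -/
theorem sum_expWeight_mul_exp_eq_tsum {N : ℕ} (hN : 0 < N) (x : ℝ)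
    (hs : Summable fun m : ℤ => (N : ℂ) * 𝓕 (fun t : ℝ => (expWeight t : ℂ)) (N * (m - x))) :
    ∑ n ∈ Finset.range N, (expWeight ((n : ℝ) / N) : ℂ) *
        Complex.exp (2 * Real.pi * Complex.I * (n * x)) =
      ∑' m : ℤ, (N : ℂ) * 𝓕 (fun t : ℝ => (expWeight t : ℂ)) (N * (m - x)) := by
  have hN' : (0 : ℝ) < N := by exact_mod_cast hN
  set g : ℝ → ℂ := fun t =>
    (expWeight (t / N) : ℂ) * Complex.exp (2 * Real.pi * Complex.I * (t * x)) with hg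
  have hgc : Continuous g :=
    (Complex.continuous_ofReal.comp (continuous_expWeight.comp (continuous_id.div_const _))).mul
      (by fun_prop)
  have hg0 : ∀ t ∉ Set.Ioo (0 : ℝ) N, g t = 0 := by
    intro t ht
    rw [hg]
    simp only
    rw [expWeight_eq_zero, Complex.ofReal_zero, zero_mul]
    rintro ⟨h0, h1⟩
    exact ht ⟨by simpa using (div_pos_iff_of_pos_right hN').1 h0, by rwa [div_lt_one hN'] at h1⟩
  have hcs : HasCompactSupport g := HasCompactSupport.intro (K := Set.Icc 0 (N : ℝ))
    isCompact_Icc fun t ht => hg0 t fun h => ht (Set.Ioo_subset_Icc_self h)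
  have hO : g =O[Filter.cocompact ℝ] fun x : ℝ => |x| ^ (-(2 : ℝ)) := by
    rw [hasCompactSupport_iff_eventuallyEq, Filter.coclosedCompact_eq_cocompact] at hcs
    exact hcs.trans_isBigO (Asymptotics.isBigO_zero _ _)
  have hF : ∀ m : ℤ, 𝓕 g m = (N : ℂ) * 𝓕 (fun t : ℝ => (expWeight t : ℂ)) (N * (m - x)) :=
    fun m => fourier_expWeight_modulated hN' x m
  have hP := Real.tsum_eq_tsum_fourier_of_rpow_decay_of_summable hgc one_lt_two hO
    (by simpa only [hF] using hs) 0
  simp only [zero_add, hF, QuotientAddGroup.mk_zero, fourier_eval_zero, mul_one] at hP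
  -- The weight vanishes outside the open interval `(0, N)`, so the sum over all integers is the
  -- finite one.
  rw [← hP, tsum_eq_sum (s := (Finset.range N).map Nat.castEmbedding), Finset.sum_map]
  · simp [hg]
  · intro n hn
    refine hg0 _ fun h => hn ?_
    have h0 : 0 < n := by exact_mod_cast h.1
    have h1 : n < N := by exact_mod_cast h.2
    simp only [Finset.mem_map, Finset.mem_range]
    exact ⟨n.toNat, by omega, by simp [h0.le]⟩

-- After Poisson summation the rate `κ` is split in two: one half keeps the decay in `N δ`, the
-- other makes the sum over `m` converge.
open FourierTransform in
theorem exists_norm_sum_expWeight_mul_exp_le :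
    ∃ S κ : ℝ, 0 < S ∧ 0 < κ ∧ ∀ (N : ℕ), 0 < N → ∀ x δ : ℝ, (∀ n : ℤ, δ ≤ |x - n|) →
      ‖∑ n ∈ Finset.range N, (expWeight ((n : ℝ) / N) : ℂ) *
        Complex.exp (2 * Real.pi * Complex.I * (n * x))‖ ≤ N * S * Real.exp (-(κ * √(N * δ))) := by
  obtain ⟨D, κ, hD, hκ, hb⟩ := exists_norm_fourier_expWeight_le
  have hsum := summable_exp_neg_mul_sqrt_abs (half_pos hκ)
  set A := ∑' n : ℤ, Real.exp (-(κ / 2 * √|(n : ℝ)|))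
  have hA0 : 0 < A := hsum.tsum_pos (fun _ => (Real.exp_pos _).le) 0 (Real.exp_pos _)
  have main : ∀ (N : ℕ), 0 < N → ∀ x δ : ℝ, 0 ≤ x → x ≤ 1 → (∀ n : ℤ, δ ≤ |x - n|) →
      ‖∑ n ∈ Finset.range N, (expWeight ((n : ℝ) / N) : ℂ) *
        Complex.exp (2 * Real.pi * Complex.I * (n * x))‖ ≤
        N * (D * Real.exp (κ / 2) * A) * Real.exp (-(κ / 2 * √(N * δ))) := by
    intro N hN x δ hx0 hx1 hδ
    have hN1 : (1 : ℝ) ≤ N := by exact_mod_cast hN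
    have hterm : ∀ m : ℤ, ‖(N : ℂ) * 𝓕 (fun t : ℝ => (expWeight t : ℂ)) (N * (m - x))‖ ≤
        (N * (D * Real.exp (κ / 2)) * Real.exp (-(κ / 2 * √(N * δ)))) *
          Real.exp (-(κ / 2 * √|(m : ℝ)|)) := by
      intro m
      rw [norm_mul, Complex.norm_natCast]
      have h1 : √(N * δ) ≤ √|N * (m - x)| := by
        apply Real.sqrt_le_sqrt
        rw [abs_mul, abs_of_nonneg (by linarith : (0 : ℝ) ≤ N), abs_sub_comm]
        exact mul_le_mul_of_nonneg_left (hδ m) (by linarith)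
      have h2 : √|(m : ℝ)| ≤ √|N * (m - x)| + 1 := by
        refine (sqrt_abs_le_sqrt_abs_sub_add_one hx0 hx1).trans ?_
        refine add_le_add (Real.sqrt_le_sqrt ?_) le_rfl
        rw [abs_mul, abs_of_nonneg (by linarith : (0 : ℝ) ≤ N)]
        exact le_mul_of_one_le_left (abs_nonneg _) hN1
      calc (N : ℝ) * ‖𝓕 (fun t : ℝ => (expWeight t : ℂ)) (N * (m - x))‖
          ≤ N * (D * Real.exp (-(κ * √|N * (m - x)|))) := by gcongr; exact hb _
        _ ≤ N * (D * Real.exp (κ / 2 + -(κ / 2 * √(N * δ)) + -(κ / 2 * √|(m : ℝ)|))) := by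
            gcongr
            nlinarith
        _ = _ := by rw [Real.exp_add, Real.exp_add]; ring
    have hsum' := hsum.mul_left (N * (D * Real.exp (κ / 2)) * Real.exp (-(κ / 2 * √(N * δ))))
    rw [sum_expWeight_mul_exp_eq_tsum hN x (Summable.of_norm_bounded hsum' hterm)]
    refine (tsum_of_norm_bounded hsum'.hasSum hterm).trans_eq ?_
    rw [tsum_mul_left]
    ring
  refine ⟨D * Real.exp (κ / 2) * A, κ / 2, by positivity, by positivity, ?_⟩
  intro N hN x δ hδ
  -- Both the exponential sum and the distance to the integers depend only on `x` modulo one.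
  have h := main N hN (Int.fract x) δ (Int.fract_nonneg x) (Int.fract_lt_one x).le (fun n => by
    have := hδ (n + ⌊x⌋)
    rw [Int.fract]
    push_cast at this
    rwa [show x - ((n : ℝ) + ⌊x⌋) = x - ⌊x⌋ - n by ring] at this)
  convert h using 4 with n _
  rw [Complex.exp_eq_exp_iff_exists_int]
  refine ⟨n * ⌊x⌋, ?_⟩
  nth_rewrite 1 [← Int.floor_add_fract x]
  push_cast
  ring

/-! ### One-dimensional Fourier coefficients of smooth periodic functions -/

/-- Integrate by parts `m` times: periodicity cancels the boundary terms, and each step gains `2π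
|n| ≥ |n|`. -/
theorem norm_integral_exp_mul_mul_pow_le {h : ℝ → ℂ} (hp : Function.Periodic h 1)
    (hh : ContDiff ℝ (⊤ : ℕ∞) h) (n : ℤ) {C : ℝ} {m : ℕ} (hC : ∀ t, ‖iteratedDeriv m h t‖ ≤ C) :
    ‖∫ s in (0 : ℝ)..1, h s * Complex.exp (2 * Real.pi * Complex.I * n * s)‖ * |(n : ℝ)| ^ m ≤
      C := by
  have he : ∀ s : ℝ, ‖Complex.exp (2 * Real.pi * Complex.I * n * s)‖ = 1 := by
    intro s
    rw [show (2 * Real.pi * Complex.I * n * s : ℂ) = ((2 * Real.pi * n * s : ℝ) : ℂ) * Complex.I by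
      push_cast; ring, Complex.norm_exp_ofReal_mul_I]
  induction m generalizing h with
  | zero =>
    rw [pow_zero, mul_one]
    refine (intervalIntegral.norm_integral_le_of_norm_le_const (C := C) fun s _ => ?_).trans
      (by simp)
    rw [norm_mul, he, mul_one]
    simpa using hC s
  | succ m ih =>
    have hh' : ContDiff ℝ (⊤ : ℕ∞) (deriv h) :=
      ((contDiff_succ_iff_deriv (n := (⊤ : ℕ∞))).1 (by exact_mod_cast hh)).2.2
    have hd : Differentiable ℝ h := hh.differentiable (by simp)
    have hp' : Function.Periodic (deriv h) 1 := by
      intro t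
      rw [← deriv_comp_add_const, hp.funext]
    have h1 := ih (h := deriv h) hp' hh' (fun t => by rw [← iteratedDeriv_succ']; exact hC t)
    have hibp : ∫ s in (0 : ℝ)..1, h s * ((2 * Real.pi * Complex.I * n) *
        Complex.exp (2 * Real.pi * Complex.I * n * s)) =
        -∫ s in (0 : ℝ)..1, deriv h s * Complex.exp (2 * Real.pi * Complex.I * n * s) := by
      rw [intervalIntegral.integral_mul_deriv_eq_deriv_mul (u' := deriv h)
        (v := fun s : ℝ => Complex.exp (2 * Real.pi * Complex.I * n * s))]
      · have e1 : Complex.exp (2 * Real.pi * Complex.I * n * (1 : ℝ)) = 1 := by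
          rw [Complex.exp_eq_one_iff]; exact ⟨n, by push_cast; ring⟩
        have e2 : h 1 = h 0 := by simpa using hp 0
        rw [e1, e2]
        simp
      · exact fun s _ => (hd s).hasDerivAt
      · intro s _
        have := ((Complex.ofRealCLM.hasDerivAt (x := s)).const_mul
          (2 * Real.pi * Complex.I * n : ℂ)).cexp
        simpa [mul_comm] using this
      · exact hh'.continuous.intervalIntegrable _ _
      · exact (by fun_prop : Continuous fun s : ℝ => (2 * Real.pi * Complex.I * n) *
          Complex.exp (2 * Real.pi * Complex.I * n * s)).intervalIntegrable _ _
    rw [intervalIntegral.integral_congr (fun s _ => mul_left_comm (h s) _ _),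
      intervalIntegral.integral_const_mul] at hibp
    have hn := congrArg norm hibp
    rw [norm_neg, norm_mul] at hn
    rw [← hn] at h1
    have hc : |(n : ℝ)| ≤ ‖(2 * Real.pi * Complex.I * n : ℂ)‖ := by
      rw [norm_mul, Complex.norm_intCast, norm_mul, norm_mul, Complex.norm_I,
        Complex.norm_real, Real.norm_of_nonneg Real.pi_pos.le, Complex.norm_ofNat, mul_one]
      exact le_mul_of_one_le_left (abs_nonneg _) (by linarith [Real.pi_gt_three])
    refine le_trans ?_ h1
    rw [pow_succ']
    calc _ = |(n : ℝ)| * ‖∫ s in (0 : ℝ)..1,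
            h s * Complex.exp (2 * Real.pi * Complex.I * n * s)‖ * |(n : ℝ)| ^ m := by ring
      _ ≤ _ := by gcongr

/-! ### The torus -/

section Torus

open UnitAddTorus MeasureTheory

variable {d : ℕ}

theorem toTorus_add (x y : Fin d → ℝ) : toTorus (x + y) = toTorus x + toTorus y := rfl

theorem isOpenQuotientMap_toTorus : IsOpenQuotientMap (toTorus (d := d)) :=
  IsOpenQuotientMap.piMap fun _ => QuotientAddGroup.isOpenQuotientMap_mk

theorem continuous_toTorus : Continuous (toTorus (d := d)) := isOpenQuotientMap_toTorus.continuous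

theorem toTorus_fract (x : Fin d → ℝ) : toTorus (fun i => Int.fract (x i)) = toTorus x := by
  ext i
  simp only [toTorus]
  rw [← sub_eq_zero, ← AddCircle.coe_sub, AddCircle.coe_eq_zero_iff]
  exact ⟨-⌊x i⌋, by rw [← Int.self_sub_floor]; simp⟩

theorem mFourier_apply_add (k : Fin d → ℤ) (a b : UnitAddTorus (Fin d)) :
    mFourier k (a + b) = mFourier k a * mFourier k b := by
  simp only [mFourier, ContinuousMap.coe_mk, ← Finset.prod_mul_distrib, Pi.add_apply]
  refine Finset.prod_congr rfl fun i _ => ?_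
  simp [fourier_apply, smul_add, AddCircle.toCircle_add]

theorem mFourier_toTorus (k : Fin d → ℤ) (x : Fin d → ℝ) :
    mFourier k (toTorus x) =
      Complex.exp (2 * Real.pi * Complex.I * ((∑ i, (k i : ℝ) * x i : ℝ) : ℂ)) := by
  simp only [mFourier, ContinuousMap.coe_mk, toTorus]
  rw [Complex.ofReal_sum, Finset.mul_sum, Complex.exp_sum]
  refine Finset.prod_congr rfl fun i _ => ?_
  rw [fourier_coe_apply]
  congr 1
  push_cast
  ring

theorem norm_mFourier_apply (k : Fin d → ℤ) (θ : UnitAddTorus (Fin d)) : ‖mFourier k θ‖ = 1 := by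
  simp only [mFourier, ContinuousMap.coe_mk, fourier_apply, norm_prod, Circle.norm_coe,
    Finset.prod_const_one]

theorem torusMean_eq_mFourierCoeff_zero (g : UnitAddTorus (Fin d) → ℂ) :
    torusMean g = mFourierCoeff g 0 := by
  unfold torusMean mFourierCoeff
  simp only [neg_zero, mFourier_zero, ContinuousMap.one_apply, one_smul]
  rfl

/-- `g` extends, along every coordinate line through every point of the torus, to a holomorphic
function on the disc of radius `r` that is bounded by `B`. -/
def HasDiscExtensions {E : Type*} [NormedAddCommGroup E] [NormedSpace ℂ E]
    (g : UnitAddTorus (Fin d) → E) (B r : ℝ) : Prop :=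
  ∀ (θ : UnitAddTorus (Fin d)) (j : Fin d), ∃ G : ℂ → E,
    DifferentiableOn ℂ G (Metric.ball 0 r) ∧ (∀ z ∈ Metric.ball (0 : ℂ) r, ‖G z‖ ≤ B) ∧
      ∀ s : ℝ, |s| < r → g (θ + toTorus (Pi.single j s)) = G s

theorem HasDiscExtensions.clm_comp {E : Type*} [NormedAddCommGroup E] [NormedSpace ℂ E]
    {g : UnitAddTorus (Fin d) → E} {B r : ℝ} (h : HasDiscExtensions g B r) {ℓ : E →L[ℂ] ℂ}
    (hl : ‖ℓ‖ ≤ 1) : HasDiscExtensions (fun θ => ℓ (g θ)) B r := by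
  intro θ j
  obtain ⟨G, hd, hb, he⟩ := h θ j
  refine ⟨fun z => ℓ (G z), fun z hz => ℓ.differentiableAt.comp_differentiableWithinAt z (hd z hz),
    fun z hz => ?_, fun s hs => congrArg ℓ (he s hs)⟩
  exact (ℓ.le_of_opNorm_le hl _).trans (by rw [one_mul]; exact hb z hz)

/-- Moving the base point along the line gives a disc of the same radius about every real `t`; the
Cauchy estimate is taken on the concentric disc of radius `r / 2`. -/
theorem HasDiscExtensions.contDiff_line {g : UnitAddTorus (Fin d) → ℂ} {B r : ℝ} (hr : 0 < r)
    (h : HasDiscExtensions g B r) (θ : UnitAddTorus (Fin d)) (j : Fin d) :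
    ContDiff ℝ (⊤ : ℕ∞) (fun s : ℝ => g (θ + toTorus (Pi.single j s))) ∧
      ∀ (m : ℕ) (t : ℝ), ‖iteratedDeriv m (fun s : ℝ => g (θ + toTorus (Pi.single j s))) t‖ ≤
        m.factorial * B / (r / 2) ^ m := by
  set φ : ℝ → ℂ := fun s => g (θ + toTorus (Pi.single j s)) with hφ
  have key : ∀ t : ℝ, ∃ G : ℂ → ℂ, DifferentiableOn ℂ G (Metric.ball (t : ℂ) r) ∧
      (∀ z ∈ Metric.ball (t : ℂ) r, ‖G z‖ ≤ B) ∧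
      ∀ s : ℝ, (s : ℂ) ∈ Metric.ball (t : ℂ) r → φ s = G s := by
    intro t
    obtain ⟨G, hd, hb, he⟩ := h (θ + toTorus (Pi.single j t)) j
    have hmaps : ∀ z ∈ Metric.ball (t : ℂ) r, z - t ∈ Metric.ball (0 : ℂ) r := fun z hz => by
      simpa [dist_eq_norm] using hz
    refine ⟨fun z => G (z - t), ?_, fun z hz => hb _ (hmaps z hz), fun s hs => ?_⟩
    · exact hd.comp (differentiableOn_id.sub_const _) hmaps
    · have hs' := hmaps s hs
      rw [mem_ball_zero_iff, ← Complex.ofReal_sub, Complex.norm_real, Real.norm_eq_abs] at hs'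
      simp only [hφ]
      rw [← Complex.ofReal_sub, ← he _ hs']
      rw [add_assoc, ← toTorus_add, ← Pi.single_add, add_sub_cancel]
  refine ⟨contDiff_iff_contDiffAt.2 fun t => ?_, fun m t => ?_⟩
  · obtain ⟨G, hd, -, he⟩ := key t
    have hG : ContDiffAt ℝ (⊤ : ℕ∞) G (t : ℂ) :=
      ((hd.analyticAt (Metric.ball_mem_nhds _ hr)).contDiffAt (n := (⊤ : ℕ∞))).restrict_scalars ℝ
    refine (hG.comp t Complex.ofRealCLM.contDiff.contDiffAt).congr_of_eventuallyEq ?_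
    filter_upwards [Complex.continuous_ofReal.continuousAt.eventually
      (Metric.ball_mem_nhds (t : ℂ) hr)] with s hs
    exact he s hs
  · obtain ⟨G, hd, hb, he⟩ := key t
    rw [iteratedDeriv_eq_of_eqOn_ofReal Metric.isOpen_ball hd he m t (Metric.mem_ball_self hr)]
    have hsub : Metric.closedBall (t : ℂ) (r / 2) ⊆ Metric.ball (t : ℂ) r :=
      Metric.closedBall_subset_ball (by linarith)
    exact Complex.norm_iteratedDeriv_le_of_forall_mem_sphere_norm_le m (by positivity)
      ((hd.mono (Metric.closure_ball_subset_closedBall.trans hsub)).diffContOnCl)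
      fun z hz => hb z (hsub (Metric.sphere_subset_closedBall hz))

/-- By translation invariance the coefficient may be averaged over shifts `s ∈ [0, 1]` in direction
`j`. After Fubini the inner integral is a one-dimensional Fourier coefficient of frequency `k j`. -/
theorem norm_mFourierCoeff_mul_pow_le {g : UnitAddTorus (Fin d) → ℂ} (hg : Continuous g) {B r : ℝ}
    (hr : 0 < r) (h : HasDiscExtensions g B r) (k : Fin d → ℤ) (j : Fin d) (m : ℕ) :
    ‖mFourierCoeff g k‖ * |(k j : ℝ)| ^ m ≤ m.factorial * B / (r / 2) ^ m := by
  set μ : Measure (UnitAddTorus (Fin d)) :=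
    Measure.pi fun _ : Fin d => (AddCircle.haarAddCircle (T := (1 : ℝ))) with hμ
  have hcoeff : mFourierCoeff g k = ∫ t, mFourier (-k) t * g t ∂μ := rfl
  have hshift : ∀ s : ℝ, mFourierCoeff g k = ∫ t, mFourier (-k) (t + toTorus (Pi.single j s)) *
      g (t + toTorus (Pi.single j s)) ∂μ := fun s => by
    rw [hcoeff, integral_add_right_eq_self (μ := μ) (fun t => mFourier (-k) t * g t)]
  have hcs : Continuous fun p : ℝ × UnitAddTorus (Fin d) => p.2 + toTorus (Pi.single j p.1) :=
    continuous_snd.add (continuous_toTorus.comp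
      ((continuous_single (A := fun _ : Fin d => ℝ) j).comp continuous_fst))
  have hcont : Continuous (Function.uncurry fun (s : ℝ) (t : UnitAddTorus (Fin d)) =>
      mFourier (-k) (t + toTorus (Pi.single j s)) * g (t + toTorus (Pi.single j s))) :=
    ((mFourier (-k)).continuous.comp hcs).mul (hg.comp hcs)
  have hswap : mFourierCoeff g k = ∫ t, (∫ s in (0 : ℝ)..1,
      mFourier (-k) (t + toTorus (Pi.single j s)) * g (t + toTorus (Pi.single j s))) ∂μ := by
    rw [← intervalIntegral_integral_swap]
    · simp_rw [← hshift]
      simp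
    · obtain ⟨A, hA⟩ := (isCompact_univ.image hg).isBounded.exists_norm_le
      have : IsFiniteMeasure (volume.restrict (Set.uIoc (0 : ℝ) 1)) := by
        rw [Set.uIoc_of_le zero_le_one]; infer_instance
      refine Integrable.of_bound hcont.aestronglyMeasurable A (Filter.Eventually.of_forall ?_)
      rintro ⟨s, t⟩
      simp only [Function.uncurry, norm_mul, norm_mFourier_apply, one_mul]
      exact hA _ ⟨_, trivial, rfl⟩
  have hinner : ∀ t, ‖∫ s in (0 : ℝ)..1,
      mFourier (-k) (t + toTorus (Pi.single j s)) * g (t + toTorus (Pi.single j s))‖ *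
        |(k j : ℝ)| ^ m ≤ m.factorial * B / (r / 2) ^ m := by
    intro t
    obtain ⟨hsm, hbd⟩ := h.contDiff_line hr t j
    have hp : Function.Periodic (fun s : ℝ => g (t + toTorus (Pi.single j s))) 1 := by
      intro s
      have : toTorus (Pi.single j (1 : ℝ)) = (0 : UnitAddTorus (Fin d)) := by
        ext i
        by_cases hi : i = j
        · subst hi
          simp [toTorus]
        · simp [toTorus, hi]
      simp only
      rw [Pi.single_add, toTorus_add, this, add_zero]
    have h1 := norm_integral_exp_mul_mul_pow_le hp hsm (-(k j)) (hbd m)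
    have h2 : ∫ s in (0 : ℝ)..1,
        mFourier (-k) (t + toTorus (Pi.single j s)) * g (t + toTorus (Pi.single j s)) =
        mFourier (-k) t * ∫ s in (0 : ℝ)..1, g (t + toTorus (Pi.single j s)) *
          Complex.exp (2 * Real.pi * Complex.I * ((-(k j) : ℤ) : ℂ) * s) := by
      rw [← intervalIntegral.integral_const_mul]
      congr 1
      ext s
      rw [mFourier_apply_add, mFourier_toTorus]
      rw [Finset.sum_eq_single j (fun i _ hi => by simp [hi]) (by simp)]
      simp only [Pi.single_eq_same, Pi.neg_apply]
      push_cast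
      ring_nf
    rw [h2, norm_mul, norm_mFourier_apply, one_mul]
    simpa using h1
  rcases eq_or_lt_of_le (show 0 ≤ |(k j : ℝ)| ^ m by positivity) with h0 | h0
  · rw [← h0, mul_zero]
    have := hinner 0
    rwa [← h0, mul_zero] at this
  · rw [← le_div_iff₀ h0, hswap]
    refine (norm_integral_le_of_norm_le_const (C := m.factorial * B / (r / 2) ^ m / |(k j : ℝ)| ^ m)
      (Filter.Eventually.of_forall fun t => ?_)).trans (by
        rw [probReal_univ, mul_one])
    rw [le_div_iff₀ h0]
    exact hinner t

theorem exists_l1Length_le_mul_abs (hd : 1 ≤ d) (k : Fin d → ℤ) :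
    ∃ j, l1Length k ≤ d * |(k j : ℝ)| := by
  have : Nonempty (Fin d) := ⟨⟨0, hd⟩⟩
  obtain ⟨j, -, hj⟩ := Finset.exists_max_image Finset.univ (fun i => |(k i : ℝ)|)
    Finset.univ_nonempty
  refine ⟨j, ?_⟩
  calc l1Length k ≤ ∑ _i : Fin d, |(k j : ℝ)| := Finset.sum_le_sum fun i hi => hj i hi
    _ = _ := by simp

/-- Here only one factorial is lost, so the optimisation over `m` runs with `s = 1` and gives a true
exponential. The largest coordinate of `k` is used, whence the `d` in the rate. -/
theorem norm_mFourierCoeff_le (hd : 1 ≤ d) {g : UnitAddTorus (Fin d) → ℂ} (hg : Continuous g)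
    {B r : ℝ} (hB : 0 ≤ B) (hr : 0 < r) (h : HasDiscExtensions g B r) (k : Fin d → ℤ) :
    ‖mFourierCoeff g k‖ ≤
      B * Real.exp 1 * Real.exp (-(r / (2 * Real.exp 1 * d) * l1Length k)) := by
  obtain ⟨j, hj⟩ := exists_l1Length_le_mul_abs hd k
  have he := Real.exp_pos 1
  have hd' : (0 : ℝ) < d := by exact_mod_cast hd
  have h1 := le_exp_neg_rpow_of_forall_mul_pow_le (a := ‖mFourierCoeff g k‖) (B := B) (K := 2 / r)
    (x := |(k j : ℝ)|) (s := 1) one_ne_zero hB (by positivity) (abs_nonneg _) (fun m => by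
      refine (norm_mFourierCoeff_mul_pow_le hg hr h k j m).trans ?_
      calc m.factorial * B / (r / 2) ^ m = B * ((2 / r) ^ m * m.factorial) := by
            rw [div_pow, div_pow]; field_simp
        _ ≤ B * ((2 / r) ^ m * (m : ℝ) ^ m) := by gcongr; exact factorial_le_natCast_pow m
        _ = _ := by rw [pow_one, mul_pow])
  refine h1.trans ?_
  rw [Nat.cast_one, inv_one, Real.rpow_one]
  gcongr
  calc r / (2 * Real.exp 1 * d) * l1Length k
      ≤ r / (2 * Real.exp 1 * d) * (d * |(k j : ℝ)|) := by gcongr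
    _ = _ := by field_simp

theorem AnalyticNearTorus.continuous {E : Type*} [NormedAddCommGroup E] [NormedSpace ℂ E]
    {f : UnitAddTorus (Fin d) → E} (hf : AnalyticNearTorus f) : Continuous f := by
  obtain ⟨U, F, -, hF, hx⟩ := hf
  rw [isOpenQuotientMap_toTorus.isQuotientMap.continuous_iff]
  have : f ∘ toTorus = fun x => F (fun i => (x i : ℂ)) := funext fun x => ((hx x).2).symm
  rw [this]
  exact hF.continuousOn.comp_continuous
    (continuous_pi fun i => Complex.continuous_ofReal.comp (continuous_apply i)) fun x => (hx x).1

theorem AnalyticNearTorus.exists_hasDiscExtensions {E : Type*} [NormedAddCommGroup E]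
    [NormedSpace ℂ E] {f : UnitAddTorus (Fin d) → E} (hf : AnalyticNearTorus f) :
    ∃ B r : ℝ, 0 < B ∧ 0 < r ∧ HasDiscExtensions f B r := by
  obtain ⟨U, F, hU, hF, hx⟩ := hf
  have hofReal : Continuous fun (x : Fin d → ℝ) (i : Fin d) => (x i : ℂ) :=
    continuous_pi fun i => Complex.continuous_ofReal.comp (continuous_apply i)
  set K : Set (Fin d → ℂ) := (fun (x : Fin d → ℝ) (i : Fin d) => (x i : ℂ)) '' Set.Icc 0 1 with hK
  have hKc : IsCompact K := isCompact_Icc.image hofReal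
  obtain ⟨r, hr, hrU⟩ := hKc.exists_cthickening_subset_open hU
    (by rintro _ ⟨x, -, rfl⟩; exact (hx x).1)
  obtain ⟨B, hB⟩ := ((hKc.cthickening (r := r)).image_of_continuousOn
    (hF.continuousOn.mono hrU)).isBounded.exists_norm_le
  refine ⟨max B 1, r, by positivity, hr, fun θ j => ?_⟩
  obtain ⟨x₀, rfl⟩ := isOpenQuotientMap_toTorus.surjective θ
  -- The extension `F` need not be periodic, so base points are first moved into the compact unit
  -- cube, whose thickening lies in `U`.
  rw [← toTorus_fract x₀]
  set x : Fin d → ℝ := fun i => Int.fract (x₀ i) with hxdef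
  have hxK : (fun i => (x i : ℂ)) ∈ K :=
    ⟨x, ⟨fun i => Int.fract_nonneg _, fun i => (Int.fract_lt_one _).le⟩, rfl⟩
  set L : ℂ → (Fin d → ℂ) := fun z => (fun i => (x i : ℂ)) + Pi.single j z with hL
  have hLmem : ∀ z ∈ Metric.ball (0 : ℂ) r, L z ∈ Metric.cthickening r K := by
    intro z hz
    refine Metric.mem_cthickening_of_dist_le _ _ _ _ hxK ?_
    rw [dist_eq_norm, hL]
    simp only [add_sub_cancel_left]
    rw [Pi.norm_single]
    exact (mem_ball_zero_iff.1 hz).le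
  have hLd : Differentiable ℂ L := by
    refine (differentiable_const _).add ?_
    exact (ContinuousLinearMap.single ℂ (fun _ : Fin d => ℂ) j).differentiable
  refine ⟨fun z => F (L z), ?_, fun z hz => (hB _ ⟨_, hLmem z hz, rfl⟩).trans (le_max_left _ _),
    fun s hs => ?_⟩
  · exact hF.differentiableOn.comp hLd.differentiableOn fun z hz => hrU (hLmem z hz)
  · rw [← toTorus_add, ← (hx _).2]
    congr 1
    ext i
    by_cases hi : i = j
    · subst hi; simp [hL]
    · simp [hL, hi]

/-! ### Weighted averages -/

theorem l1Length_pos {d : ℕ} {k : Fin d → ℤ} (hk : k ≠ 0) : 0 < l1Length k := by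
  obtain ⟨i, hi⟩ := Function.ne_iff.1 hk
  refine Finset.sum_pos' (fun _ _ => abs_nonneg _) ⟨i, Finset.mem_univ i, ?_⟩
  exact abs_pos.2 (by exact_mod_cast hi)

theorem summable_exp_neg_mul_l1Length {c : ℝ} (hc : 0 < c) (d : ℕ) :
    Summable fun k : Fin d → ℤ => Real.exp (-(c * l1Length k)) := by
  induction d with
  | zero => exact Summable.of_finite
  | succ d ih =>
    have h1 : Summable fun n : ℤ => Real.exp (-(c * |(n : ℝ)|)) := by
      refine Summable.of_nonneg_of_le (fun _ => (Real.exp_pos _).le) (fun n => ?_)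
        (summable_exp_neg_mul_sqrt_abs hc)
      gcongr
      rw [Real.sqrt_le_left (abs_nonneg _)]
      rcases eq_or_ne n 0 with rfl | hn
      · simp
      · exact le_self_pow₀ (by exact_mod_cast Int.one_le_abs hn) two_ne_zero
    have h2 := h1.mul_of_nonneg ih (fun _ => (Real.exp_pos _).le) (fun _ => (Real.exp_pos _).le)
    refine ((Fin.consEquiv fun _ : Fin (d + 1) => ℤ).summable_iff).1 (h2.congr fun p => ?_)
    rw [← Real.exp_add]
    simp only [Function.comp, Fin.consEquiv_apply, l1Length, Fin.sum_univ_succ, Fin.cons_zero,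
      Fin.cons_succ]
    congr 1
    ring

/-- Balancing an exponential rate against a small divisor. -/
theorem min_mul_rpow_le {r c τ α x X : ℝ} (hr : 0 ≤ r) (hc : 0 ≤ c) (hτ : 0 ≤ τ) (hα : 0 ≤ α)
    (hx : 0 < x) (hX : 0 < X) :
    min r (c * √α) * X ^ ((1 / 2 : ℝ) / (1 + τ * (1 / 2))) ≤ r * x + c * √(X * (α / x ^ τ)) := by
  set ξ : ℝ := (1 / 2 : ℝ) / (1 + τ * (1 / 2)) with hξ
  have hXξ : 0 < X ^ ξ := Real.rpow_pos_of_pos hX _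
  -- For `x ≥ X^ξ` the linear term suffices; below it the divisor is large enough, because `2ξ + ξτ
  -- = 1`.
  rcases le_or_gt (X ^ ξ) x with h | h
  · calc min r (c * √α) * X ^ ξ ≤ r * x := by gcongr; exact min_le_left _ _
      _ ≤ _ := le_add_of_nonneg_right (by positivity)
  · have hden : x ^ τ ≤ X ^ (ξ * τ) := by
      rw [Real.rpow_mul hX.le]
      exact Real.rpow_le_rpow hx.le h.le hτ
    have hexp : X = X ^ ξ * X ^ ξ * X ^ (ξ * τ) := by
      rw [← Real.rpow_add hX, ← Real.rpow_add hX]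
      have : ξ + ξ + ξ * τ = 1 := by rw [hξ]; field_simp; ring
      rw [this, Real.rpow_one]
    have hsq : √α * X ^ ξ ≤ √(X * (α / x ^ τ)) := by
      apply Real.le_sqrt_of_sq_le
      rw [mul_pow, Real.sq_sqrt hα, ← mul_div_assoc, le_div_iff₀ (by positivity)]
      calc α * (X ^ ξ) ^ 2 * x ^ τ ≤ α * (X ^ ξ) ^ 2 * X ^ (ξ * τ) := by gcongr
        _ = X * α := by nth_rewrite 3 [hexp]; ring
    calc min r (c * √α) * X ^ ξ ≤ c * √α * X ^ ξ := by gcongr; exact min_le_right _ _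
      _ = c * (√α * X ^ ξ) := by ring
      _ ≤ c * √(X * (α / x ^ τ)) := by gcongr
      _ ≤ _ := le_add_of_nonneg_left (by positivity)

/-- If an average of `g` is computed term by term from averages `a k` of the characters, and
these are small by nonresonance, then it is close to the mean of `g`. -/
theorem norm_sub_torusMean_le {g : UnitAddTorus (Fin d) → ℂ} {B r D c τ α X : ℝ} (hB : 0 ≤ B)
    (hr : 0 < r) (hD : 0 ≤ D) (hc : 0 ≤ c) (hτ : 0 ≤ τ) (hα : 0 ≤ α) (hX : 0 < X)
    (hg : ∀ k, ‖mFourierCoeff g k‖ ≤ B * Real.exp (-(r * l1Length k)))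
    {a : (Fin d → ℤ) → ℂ} {v : ℂ} (hv : HasSum (fun k => mFourierCoeff g k * a k) v)
    (ha0 : a 0 = 1)
    (ha : ∀ k ≠ 0, ‖a k‖ ≤ D * Real.exp (-(c * √(X * (α / l1Length k ^ τ))))) :
    ‖v - torusMean g‖ ≤ B * D * (∑' k : Fin d → ℤ, Real.exp (-(r / 2 * l1Length k))) *
      Real.exp (-(min (r / 2) (c * √α) * X ^ ((1 / 2 : ℝ) / (1 + τ * (1 / 2))))) := by
  set ε := Real.exp (-(min (r / 2) (c * √α) * X ^ ((1 / 2 : ℝ) / (1 + τ * (1 / 2))))) with hε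
  have h1 := hv.sub (hasSum_ite_eq (0 : Fin d → ℤ) (mFourierCoeff g 0))
  have hs := ((summable_exp_neg_mul_l1Length (half_pos hr) d).mul_left (B * D * ε)).hasSum
  rw [torusMean_eq_mFourierCoeff_zero, ← h1.tsum_eq]
  refine (tsum_of_norm_bounded hs fun k => ?_).trans_eq (by rw [tsum_mul_left]; ring)
  by_cases hk : k = 0
  · subst hk
    rw [if_pos rfl, ha0, mul_one, sub_self, norm_zero]
    positivity
  · rw [if_neg hk, sub_zero, norm_mul]
    -- Half of the rate `r` enters the balance; the other half sums over `k`.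
    have hopt := min_mul_rpow_le (half_pos hr).le hc hτ hα (l1Length_pos hk) hX
    calc ‖mFourierCoeff g k‖ * ‖a k‖
        ≤ (B * Real.exp (-(r * l1Length k))) *
            (D * Real.exp (-(c * √(X * (α / l1Length k ^ τ))))) := by
          gcongr
          exacts [hg k, ha k hk]
      _ = B * D * Real.exp (-(r * l1Length k) + -(c * √(X * (α / l1Length k ^ τ)))) := by
          rw [Real.exp_add]; ring
      _ ≤ B * D * Real.exp (-(min (r / 2) (c * √α) * X ^ ((1 / 2 : ℝ) / (1 + τ * (1 / 2)))) +
            -(r / 2 * l1Length k)) := by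
          refine mul_le_mul_of_nonneg_left (Real.exp_le_exp.2 ?_) (by positivity)
          linarith
      _ = _ := by rw [Real.exp_add, hε]; ring

/-! #### Discrete time -/

/-- At least `N / 8` nodes fall in `[1/4, 3/4]`, where the weight is bounded below. For `N = 1` the
only node is `0` and the sum vanishes, hence `2 ≤ N`. -/
theorem exists_mul_le_sum_expWeight :
    ∃ c : ℝ, 0 < c ∧ ∀ N : ℕ, 2 ≤ N →
      c * N ≤ ∑ n ∈ Finset.range N, expWeight ((n : ℝ) / (N : ℝ)) := by
  set w₀ : ℝ := (∫ s in (0 : ℝ)..1, expBump s)⁻¹ * Real.exp (-16) with hw₀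
  have hw₀pos : 0 < w₀ := mul_pos (inv_pos.2 integral_expBump_pos) (Real.exp_pos _)
  have hlow : ∀ x : ℝ, 1 / 4 ≤ x → x ≤ 3 / 4 → w₀ ≤ expWeight x := by
    intro x h0 h1
    rw [expWeight, expBump, if_pos ⟨by linarith, by linarith⟩]
    refine mul_le_mul_of_nonneg_left ?_ (inv_nonneg.2 integral_expBump_pos.le)
    gcongr
    have hx : x⁻¹ ≤ 4 := by rw [inv_le_comm₀ (by linarith) (by norm_num)]; linarith
    have hy : (1 - x)⁻¹ ≤ 4 := by rw [inv_le_comm₀ (by linarith) (by norm_num)]; linarith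
    have : 0 < 1 - x := by linarith
    calc x⁻¹ * (1 - x)⁻¹ ≤ 4 * 4 := by gcongr
      _ = 16 := by norm_num
  refine ⟨w₀ / 8, by positivity, fun N hN => ?_⟩
  have hN0 : (0 : ℝ) < N := by exact_mod_cast (by omega : 0 < N)
  set I := Finset.Icc ((N + 3) / 4) (3 * N / 4) with hI
  have hcard : (N : ℝ) ≤ 8 * (I.card : ℝ) := by
    have : N ≤ 8 * I.card := by rw [hI, Nat.card_Icc]; omega
    exact_mod_cast this
  calc w₀ / 8 * N ≤ w₀ / 8 * (8 * I.card) := by gcongr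
    _ = ∑ _n ∈ I, w₀ := by rw [Finset.sum_const, nsmul_eq_mul]; ring
    _ ≤ ∑ n ∈ I, expWeight ((n : ℝ) / (N : ℝ)) := by
      refine Finset.sum_le_sum fun n hn => ?_
      rw [hI, Finset.mem_Icc] at hn
      refine hlow _ ?_ ?_
      · rw [le_div_iff₀ hN0]
        have : (N : ℝ) ≤ 4 * n := by exact_mod_cast (by omega : N ≤ 4 * n)
        linarith
      · rw [div_le_iff₀ hN0]
        have : 4 * (n : ℝ) ≤ 3 * N := by exact_mod_cast (by omega : 4 * n ≤ 3 * N)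
        linarith
    _ ≤ _ := by
      refine Finset.sum_le_sum_of_subset_of_nonneg (fun n hn => ?_) fun _ _ _ => expWeight_nonneg _
      rw [hI, Finset.mem_Icc] at hn
      exact Finset.mem_range.2 (by omega)

theorem torusRotation_iterate (ρ : Fin d → ℝ) (n : ℕ) (θ : UnitAddTorus (Fin d)) :
    (torusRotation ρ)^[n] θ = θ + toTorus (fun i => (n : ℝ) * ρ i) := by
  induction n with
  | zero =>
    rw [Function.iterate_zero_apply]
    ext i
    simp [toTorus]
  | succ n ih =>
    rw [Function.iterate_succ_apply', ih, torusRotation, add_assoc, ← toTorus_add]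
    congr 2
    ext i
    simp [add_mul]

theorem hasSum_discreteAverage (ρ : Fin d → ℝ) {g : UnitAddTorus (Fin d) → ℂ}
    (hg : Continuous g) (hs : Summable (mFourierCoeff g)) (N : ℕ) (θ : UnitAddTorus (Fin d)) :
    HasSum (fun k => mFourierCoeff g k * discreteAverage ρ (mFourier k) N θ)
      (discreteAverage ρ g N θ) := by
  have hpt : ∀ x, HasSum (fun k => mFourierCoeff g k * mFourier k x) (g x) := fun x =>
    hasSum_mFourier_series_apply_of_summable (f := ⟨g, hg⟩) hs x
  have h := (hasSum_sum (s := Finset.range N) fun n _ =>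
    (hpt ((torusRotation ρ)^[n] θ)).const_smul ((expWeight ((n : ℝ) / N) : ℝ) : ℂ)).const_smul
      (((∑ n ∈ Finset.range N, expWeight ((n : ℝ) / (N : ℝ)))⁻¹ : ℝ) : ℂ)
  refine h.congr_fun fun k => ?_
  simp only [discreteAverage, smul_eq_mul, Finset.mul_sum]
  exact Finset.sum_congr rfl fun n _ => by ring

theorem discreteAverage_mFourier (ρ : Fin d → ℝ) (k : Fin d → ℤ) (N : ℕ)
    (θ : UnitAddTorus (Fin d)) :
    discreteAverage ρ (mFourier k) N θ =
      (((∑ n ∈ Finset.range N, expWeight ((n : ℝ) / (N : ℝ)))⁻¹ : ℝ) : ℂ) * (mFourier k θ *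
        ∑ n ∈ Finset.range N, (expWeight ((n : ℝ) / N) : ℂ) *
          Complex.exp (2 * Real.pi * Complex.I * (n * ((∑ i, (k i : ℝ) * ρ i : ℝ) : ℂ)))) := by
  simp only [discreteAverage, smul_eq_mul]
  congr 1
  rw [Finset.mul_sum]
  refine Finset.sum_congr rfl fun n _ => ?_
  rw [torusRotation_iterate, mFourier_apply_add, mFourier_toTorus, mul_left_comm]
  congr 4
  rw [← Complex.ofReal_natCast, ← Complex.ofReal_mul, Finset.mul_sum]
  congr 1
  exact Finset.sum_congr rfl fun i _ => by ring

theorem discreteAverage_mFourier_zero (ρ : Fin d → ℝ) {N : ℕ} (θ : UnitAddTorus (Fin d))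
    (hN : ∑ n ∈ Finset.range N, expWeight ((n : ℝ) / (N : ℝ)) ≠ 0) :
    discreteAverage ρ (mFourier (0 : Fin d → ℤ)) N θ = 1 := by
  simp only [discreteAverage, mFourier_zero, ContinuousMap.one_apply, smul_eq_mul, mul_one]
  rw [← Complex.ofReal_sum, ← Complex.ofReal_mul, inv_mul_cancel₀ hN, Complex.ofReal_one]

/-- The factor `N` in the exponential sum bound cancels against `A_N ≥ w N`. -/
theorem exists_norm_discreteAverage_mFourier_le :
    ∃ D c : ℝ, 0 < D ∧ 0 < c ∧ ∀ (d : ℕ) (ρ : Fin d → ℝ) (k : Fin d → ℤ) (δ : ℝ),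
      (∀ n : ℤ, δ ≤ |(∑ i, (k i : ℝ) * ρ i) - n|) → ∀ N : ℕ, 2 ≤ N → ∀ θ,
        ‖discreteAverage ρ (mFourier k) N θ‖ ≤ D * Real.exp (-(c * √(N * δ))) := by
  obtain ⟨S, κ, hS, hκ, hsum⟩ := exists_norm_sum_expWeight_mul_exp_le
  obtain ⟨w, hw, hA⟩ := exists_mul_le_sum_expWeight
  refine ⟨w⁻¹ * S, κ, by positivity, hκ, fun d ρ k δ hδ N hN θ => ?_⟩
  have hN0 : (0 : ℝ) < N := by exact_mod_cast (by omega : 0 < N)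
  have hA' := hA N hN
  have hA0 : 0 < ∑ n ∈ Finset.range N, expWeight ((n : ℝ) / (N : ℝ)) :=
    (by positivity : (0 : ℝ) < w * N).trans_le hA'
  rw [discreteAverage_mFourier, norm_mul, norm_mul, norm_mFourier_apply, one_mul, Complex.norm_real,
    Real.norm_of_nonneg (inv_nonneg.2 hA0.le)]
  calc _ ≤ (w * N)⁻¹ * (N * S * Real.exp (-(κ * √(N * δ)))) := by
        gcongr
        exact hsum N (by omega) _ δ hδ
    _ = _ := by field_simp

/-! #### Continuous time -/

theorem hasSum_continuousAverage (ρ : Fin d → ℝ) {g : UnitAddTorus (Fin d) → ℂ}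
    (hg : Continuous g) (hs : Summable (mFourierCoeff g)) (T : ℝ) (θ : UnitAddTorus (Fin d)) :
    HasSum (fun k => mFourierCoeff g k * continuousAverage ρ (mFourier k) T θ)
      (continuousAverage ρ g T θ) := by
  have hpt : ∀ x, HasSum (fun k => mFourierCoeff g k * mFourier k x) (g x) := fun x =>
    hasSum_mFourier_series_apply_of_summable (f := ⟨g, hg⟩) hs x
  have hw : Continuous fun t : ℝ => expWeight (t / T) :=
    continuous_expWeight.comp (continuous_id.div_const T)
  have hline : Continuous fun t : ℝ => toTorus (fun i => ρ i * t) + θ :=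
    (continuous_toTorus.comp (continuous_pi fun i => continuous_const.mul continuous_id)).add
      continuous_const
  have h := intervalIntegral.hasSum_integral_of_dominated_convergence (μ := volume) (a := 0)
    (b := T) (F := fun (k : Fin d → ℤ) (t : ℝ) => ((expWeight (t / T) : ℝ) : ℂ) •
      (mFourierCoeff g k * mFourier k (toTorus (fun i => ρ i * t) + θ)))
    (f := fun t => ((expWeight (t / T) : ℝ) : ℂ) • g (toTorus (fun i => ρ i * t) + θ))
    (fun k t => expWeight (t / T) * ‖mFourierCoeff g k‖)
    (fun k => ((Complex.continuous_ofReal.comp hw).smul (continuous_const.mul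
      ((mFourier k).continuous.comp hline))).aestronglyMeasurable)
    (fun k => Filter.Eventually.of_forall fun t _ => by
      rw [norm_smul, norm_mul, norm_mFourier_apply, mul_one, Complex.norm_real,
        Real.norm_of_nonneg (expWeight_nonneg _)])
    (Filter.Eventually.of_forall fun t _ => hs.norm.mul_left _)
    (by
      simp_rw [tsum_mul_left]
      exact (hw.mul continuous_const).intervalIntegrable _ _)
    (Filter.Eventually.of_forall fun t _ => (hpt _).const_smul _)
  refine (h.const_smul ((T⁻¹ : ℝ) : ℂ)).congr_fun fun k => ?_
  simp only [continuousAverage, smul_eq_mul]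
  rw [mul_left_comm, ← intervalIntegral.integral_const_mul]
  congr 2
  ext t
  ring

-- The time integral is the Fourier transform of the modulated weight at frequency zero, so no
-- Poisson summation is needed.
open FourierTransform in
theorem continuousAverage_mFourier (ρ : Fin d → ℝ) (k : Fin d → ℤ) {T : ℝ} (hT : 0 < T)
    (θ : UnitAddTorus (Fin d)) :
    continuousAverage ρ (mFourier k) T θ =
      mFourier k θ * 𝓕 (fun t : ℝ => (expWeight t : ℂ)) (T * (0 - ∑ i, (k i : ℝ) * ρ i)) := by
  have hT' : (T : ℂ) ≠ 0 := by exact_mod_cast hT.ne'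
  set x := ∑ i, (k i : ℝ) * ρ i with hx
  have h := fourier_expWeight_modulated hT x 0
  rw [Real.fourier_real_eq_integral_exp_smul] at h
  have hI : ∫ t in (0 : ℝ)..T,
      (expWeight (t / T) : ℂ) * Complex.exp (2 * Real.pi * Complex.I * (t * x)) =
      T * 𝓕 (fun t : ℝ => (expWeight t : ℂ)) (T * (0 - x)) := by
    rw [← h, intervalIntegral.integral_of_le hT.le,
      setIntegral_eq_integral_of_forall_compl_eq_zero]
    · congr 1
      ext t
      simp
    · intro t ht
      rw [expWeight_eq_zero, Complex.ofReal_zero, zero_mul]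
      rintro ⟨h0, h1⟩
      exact ht ⟨(div_pos_iff_of_pos_right hT).1 h0, ((div_lt_one hT).1 h1).le⟩
  simp only [continuousAverage, smul_eq_mul]
  have hcongr : ∀ t : ℝ, ((expWeight (t / T) : ℝ) : ℂ) *
      mFourier k (toTorus (fun i => ρ i * t) + θ) = mFourier k θ *
        ((expWeight (t / T) : ℂ) * Complex.exp (2 * Real.pi * Complex.I * (t * x))) := by
    intro t
    rw [mFourier_apply_add, mFourier_toTorus]
    have : ∑ i, (k i : ℝ) * (ρ i * t) = t * x := by
      rw [hx, Finset.mul_sum]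
      exact Finset.sum_congr rfl fun i _ => by ring
    rw [this, Complex.ofReal_mul]
    ring
  simp_rw [hcongr]
  rw [intervalIntegral.integral_const_mul, hI, Complex.ofReal_inv, mul_left_comm,
    inv_mul_cancel_left₀ hT']

theorem continuousAverage_mFourier_zero (ρ : Fin d → ℝ) {T : ℝ} (hT : 0 < T)
    (θ : UnitAddTorus (Fin d)) : continuousAverage ρ (mFourier (0 : Fin d → ℤ)) T θ = 1 := by
  simp only [continuousAverage, mFourier_zero, ContinuousMap.one_apply, smul_eq_mul, mul_one]
  rw [intervalIntegral.integral_ofReal, intervalIntegral.integral_comp_div _ hT.ne', zero_div,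
    div_self hT.ne', integral_expWeight, ← Complex.ofReal_mul, smul_eq_mul, mul_one,
    inv_mul_cancel₀ hT.ne', Complex.ofReal_one]

theorem exists_norm_continuousAverage_mFourier_le :
    ∃ D c : ℝ, 0 < D ∧ 0 < c ∧ ∀ (d : ℕ) (ρ : Fin d → ℝ) (k : Fin d → ℤ) (δ : ℝ),
      δ ≤ |∑ i, (k i : ℝ) * ρ i| → ∀ T : ℝ, 0 < T → ∀ θ,
        ‖continuousAverage ρ (mFourier k) T θ‖ ≤ D * Real.exp (-(c * √(T * δ))) := by
  obtain ⟨D, κ, hD, hκ, hb⟩ := exists_norm_fourier_expWeight_le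
  refine ⟨D, κ, hD, hκ, fun d ρ k δ hδ T hT θ => ?_⟩
  rw [continuousAverage_mFourier ρ k hT, norm_mul, norm_mFourier_apply, one_mul]
  refine (hb _).trans ?_
  gcongr
  rw [zero_sub, mul_neg, abs_neg, abs_mul, abs_of_pos hT]
  gcongr

/-! #### Banach space valued functions -/

section Dual

variable {E : Type*} [NormedAddCommGroup E] [NormedSpace ℂ E]
  {f : UnitAddTorus (Fin d) → E} (ℓ : E →L[ℂ] ℂ)

theorem clm_torusMean [CompleteSpace E] (hf : Continuous f) : ℓ (torusMean f) = torusMean fun θ => ℓ (f θ) := by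
  refine (ℓ.integral_comp_comm ?_).symm
  obtain ⟨A, hA⟩ := (isCompact_univ.image hf).isBounded.exists_norm_le
  exact Integrable.of_bound hf.aestronglyMeasurable A
    (Filter.Eventually.of_forall fun θ => hA _ ⟨θ, trivial, rfl⟩)

theorem clm_discreteAverage (ρ : Fin d → ℝ) (N : ℕ) (θ : UnitAddTorus (Fin d)) :
    ℓ (discreteAverage ρ f N θ) = discreteAverage ρ (fun θ => ℓ (f θ)) N θ := by
  simp only [discreteAverage, map_smul, map_sum]

theorem clm_continuousAverage [CompleteSpace E] (hf : Continuous f) (ρ : Fin d → ℝ)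
    (T : ℝ) (θ : UnitAddTorus (Fin d)) :
    ℓ (continuousAverage ρ f T θ) = continuousAverage ρ (fun θ => ℓ (f θ)) T θ := by
  have hw : Continuous fun t : ℝ => expWeight (t / T) :=
    continuous_expWeight.comp (continuous_id.div_const T)
  have hline : Continuous fun t : ℝ => toTorus (fun i => ρ i * t) + θ :=
    (continuous_toTorus.comp (continuous_pi fun i => continuous_const.mul continuous_id)).add
      continuous_const
  simp only [continuousAverage, map_smul]
  rw [← ContinuousLinearMap.intervalIntegral_comp_comm]
  · simp only [map_smul]
  · exact ((Complex.continuous_ofReal.comp hw).smul (hf.comp hline)).intervalIntegrable _ _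

end Dual

end Torus

/-! ### The main theorem -/

theorem corollary3p5 :
    ∃ βstar : ℝ, 0 < βstar ∧
      ∀ (d : ℕ), 1 ≤ d →
      ∀ (E : Type*) [NormedAddCommGroup E] [NormedSpace ℂ E] [CompleteSpace E]
        (f : UnitAddTorus (Fin d) → E), AnalyticNearTorus f →
      ∀ (τ α : ℝ), (d : ℝ) - 1 < τ → 0 < α →
      ∃ (C c : ℝ) (M : ℕ), 0 < C ∧ 0 < c ∧
        ∀ ρ : Fin d → ℝ,
          (DiscreteNonresonant α (fun x => x ^ τ) ρ →
            ∀ N : ℕ, M ≤ N → ∀ θ : UnitAddTorus (Fin d),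
              ‖discreteAverage ρ f N θ - torusMean f‖ ≤
                C * Real.exp (-(c * (N : ℝ) ^ (βstar / (1 + τ * βstar))))) ∧
          (ContinuousNonresonant α (fun x => x ^ τ) ρ →
            ∀ T : ℝ, (M : ℝ) ≤ T → ∀ θ : UnitAddTorus (Fin d),
              ‖continuousAverage ρ f T θ - torusMean f‖ ≤
                C * Real.exp (-(c * T ^ (βstar / (1 + τ * βstar))))) := by
  refine ⟨1 / 2, by norm_num, fun d hd E _ _ _ f hf τ α hτ hα => ?_⟩
  have hd1 : (1 : ℝ) ≤ d := by exact_mod_cast hd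
  have hτ0 : 0 ≤ τ := by linarith
  have hfc := hf.continuous
  obtain ⟨B, r, hB, hr, hdisc⟩ := hf.exists_hasDiscExtensions
  obtain ⟨D₁, c₁, hD₁, hc₁, hdiscrete⟩ := exists_norm_discreteAverage_mFourier_le
  obtain ⟨D₂, c₂, hD₂, hc₂, hcontinuous⟩ := exists_norm_continuousAverage_mFourier_le
  set B' := B * Real.exp 1
  set r' := r / (2 * Real.exp 1 * d)
  have hB'0 : 0 < B' := by positivity
  have hr'0 : 0 < r' := by positivity
  set A := ∑' k : Fin d → ℤ, Real.exp (-(r' / 2 * l1Length k))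
  have hA : 0 < A := (summable_exp_neg_mul_l1Length (half_pos hr'0) d).tsum_pos
    (fun _ => (Real.exp_pos _).le) 0 (Real.exp_pos _)
  have hα' : 0 < √α := Real.sqrt_pos.2 hα
  have hcoeff : ∀ ℓ : E →L[ℂ] ℂ, ‖ℓ‖ ≤ 1 → ∀ k,
      ‖UnitAddTorus.mFourierCoeff (fun θ => ℓ (f θ)) k‖ ≤ B' * Real.exp (-(r' * l1Length k)) :=
    fun ℓ hl k => norm_mFourierCoeff_le hd (ℓ.continuous.comp hfc) hB.le hr (hdisc.clm_comp hl) k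
  have hsummable : ∀ ℓ : E →L[ℂ] ℂ, ‖ℓ‖ ≤ 1 →
      Summable (UnitAddTorus.mFourierCoeff fun θ => ℓ (f θ)) := fun ℓ hl =>
    Summable.of_norm_bounded ((summable_exp_neg_mul_l1Length hr'0 d).mul_left B') (hcoeff ℓ hl)
  have hweaken : ∀ {C₀ C c₀ c y : ℝ}, 0 ≤ C → C₀ ≤ C → c ≤ c₀ → 0 ≤ y →
      C₀ * Real.exp (-(c₀ * y)) ≤ C * Real.exp (-(c * y)) := by
    intro C₀ C c₀ c y hC h1 h2 hy
    gcongr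
  -- The sum and the minimum serve both cases at once; `M = 2` ensures `A_N ≠ 0`.
  refine ⟨B' * D₁ * A + B' * D₂ * A, min (min (r' / 2) (c₁ * √α)) (min (r' / 2) (c₂ * √α)), 2,
    by positivity, by positivity, fun ρ => ⟨fun hρ N hN θ => ?_, fun hρ T hT θ => ?_⟩⟩
  · have hN0 : (0 : ℝ) < N := by exact_mod_cast (by omega : 0 < N)
    -- A norming functional for the error reduces to scalars. It depends on `N` and `θ`, but the
    -- bounds are uniform over `‖ℓ‖ ≤ 1`.
    obtain ⟨ℓ, hl, hnorm⟩ := exists_dual_vector'' ℂ (discreteAverage ρ f N θ - torusMean f)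
    obtain ⟨w, hw, hwA⟩ := exists_mul_le_sum_expWeight
    have hAN := ((by positivity : (0 : ℝ) < w * N).trans_le (hwA N hN)).ne'
    have h := norm_sub_torusMean_le hB'0.le hr'0 hD₁.le hc₁.le hτ0 hα.le hN0 (hcoeff ℓ hl)
      (hasSum_discreteAverage ρ (g := fun θ => ℓ (f θ)) (ℓ.continuous.comp hfc)
        (hsummable ℓ hl) N θ)
      (discreteAverage_mFourier_zero ρ θ hAN)
      fun k hk => hdiscrete d ρ k _ (hρ k hk) N hN θ
    rw [← clm_torusMean ℓ hfc, ← clm_discreteAverage ℓ, ← map_sub, hnorm, RCLike.norm_ofReal,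
      abs_norm] at h
    exact h.trans (hweaken (by positivity) (le_add_of_nonneg_right (by positivity))
      (min_le_left _ _) (by positivity))
  · have hT0 : 0 < T := by
      have : ((2 : ℕ) : ℝ) = 2 := by norm_num
      linarith
    obtain ⟨ℓ, hl, hnorm⟩ := exists_dual_vector'' ℂ (continuousAverage ρ f T θ - torusMean f)
    have h := norm_sub_torusMean_le hB'0.le hr'0 hD₂.le hc₂.le hτ0 hα.le hT0 (hcoeff ℓ hl)
      (hasSum_continuousAverage ρ (g := fun θ => ℓ (f θ)) (ℓ.continuous.comp hfc)
        (hsummable ℓ hl) T θ)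
      (continuousAverage_mFourier_zero ρ hT0 θ)
      fun k hk => hcontinuous d ρ k _ (hρ k hk) T hT0 θ
    rw [← clm_torusMean ℓ hfc, ← clm_continuousAverage ℓ hfc, ← map_sub, hnorm,
      RCLike.norm_ofReal, abs_norm] at h
    exact h.trans (hweaken (by positivity) (le_add_of_nonneg_left (by positivity))
      (min_le_right _ _) (by positivity))
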